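/- All quantum systems are finite-dimensional. A state is a positive semidefinite operator of trace one, and a channel is a completely positive trace-preserving linear map. Let $\Theta\subseteq\mathbb R$ be a parameter set, let $\{\mathcal N^{t}_{A\to B}\}_{t\in\Theta}$ be a family of quantum channels, and let $\theta\in\Theta$ be an accumulation point of $\Theta$ at which the family is differentiable (derivative $\partial_\theta$ taken along $\Theta$). Let $\Gamma^{\theta}_{RB}=(\mathrm{id}_R\otimes\mathcal N^{\theta})(|\Gamma\rangle\langle\Gamma|_{RA})$, with $|\Gamma\rangle_{RA}=\sum_i|i\rangle_R|i\rangle_A$, be the Choi operator of $\mathcal N^\theta$. The RLD Fisher information of the channel family is $$\widehat I_F(\theta;\{\mathcal N^{t}\}_{t})=\bigl\|\operatorname{Tr}_B\bigl[(\partial_\theta\Gamma^{\theta}_{RB})(\Gamma^{\theta}_{RB})^{-1}(\partial_\theta\Gamma^{\theta}_{RB})\bigr]\bigr\|_\infty\quad\text{if }\operatorname{supp}(\partial_\theta\Gamma^{\theta}_{RB})\subseteq\operatorname{supp}(\Gamma^{\theta}_{RB}),$$ and $+\infty$ otherwise, where $\|\cdot\|_\infty$ is the operator norm, the support of an operator is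 the orthogonal complement of its kernel, and the inverse is taken on the support. For $n\ge 1$, an $n$-round sequential protocol consists of finite-dimensional memory systems $R_1,\dots,R_n$, an initial state $\rho_{R_1A_1}$, channels $\mathcal S^{i}_{R_iB_i\to R_{i+1}A_{i+1}}$ for $1\le i\le n-1$, and a final POVM $\Lambda$ on $R_nB_n$ with outcomes in $\mathbb R$; none of these depends on the parameter. When the unknown channel is $\mathcal N^t$, the final state is $$\omega^{t}=(\mathcal N^{t}_{A_n\to B_n}\circ\mathcal S^{n-1}\circ\mathcal N^{t}_{A_{n-1}\to B_{n-1}}\circ\cdots\circ\mathcal S^{1}\circ\mathcal N^{t}_{A_1\to B_1})(\rho_{R_1A_1}),$$ and the estimate $\hat\theta$ is the real random variable with law $E\mapsto\operatorname{Tr}[\Lambda(E)\,\omega^{t}]$. The protocol is unbiased if, for every $t\in\Theta$, $\hat\theta$ is integrable with mean $t$ when the channel is $\mathcal N^t$. Let $\operatorname{Var}(\hat\theta)\in[0,\infty]$ be the variance of $\hat\theta$ when the channel is $\mathcal N^\theta$. 1. For every $n\ge1$ and every unbiased $n$-round sequential protocol, $$\operatorname{Var}(\hat\theta)\ \ge\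 \frac{1}{n\,\widehat I_F(\theta;\{\mathcal N^{t}\}_{t})},$$ with the conventions $1/\infty=0$ and $1/0=\infty$. 2. Consequently, finite RLD Fisher information rules out Heisenberg scaling: if $\widehat I_F(\theta;\{\mathcal N^{t}\}_{t})<\infty$, then for every $C\ge0$ there is an $n_0$ such that, for every $n\ge n_0$, every unbiased $n$-round sequential protocol satisfies $\operatorname{Var}(\hat\theta)>C/n^2$. -/

import Mathlib

open Matrix MeasureTheory ProbabilityTheory Filter Topology
open scoped ENNReal NNReal ComplexOrder

noncomputable section

namespace QEst

/-! ### States, channels, measurements (finite-dimensional systems)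

A quantum system is a finite index type `d`; its Hilbert space is `ℂ^d` and its operators are the
matrices `Matrix d d ℂ`. The composite of the systems `d` and `e` is `d × e`. -/

/-- Quantum states: positive semidefinite matrices of trace one. -/
structure State (d : Type*) [Fintype d] [DecidableEq d] where
  mat : Matrix d d ℂ
  psd : mat.PosSemidef
  trace_one : mat.trace = 1

/-- The action of `id_R ⊗ N` on operators of the composite system `R × A`:
the `(r, r')` block of the result is `N` applied to the `(r, r')` block of the argument. -/
def ampliation {R A B : Type*} (N : Matrix A A ℂ →ₗ[ℂ] Matrix B B ℂ)
    (X : Matrix (R × A) (R × A) ℂ) : Matrix (R × B) (R × B) ℂ :=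
  Matrix.of fun p q => N (Matrix.of fun a a' => X (p.1, a) (q.1, a')) p.2 q.2

/-- Quantum channels from the system `A` to the system `B`: completely positive, trace preserving
linear maps. -/
structure Channel (A B : Type*) [Fintype A] [DecidableEq A] [Fintype B] [DecidableEq B] where
  toFun : Matrix A A ℂ →ₗ[ℂ] Matrix B B ℂ
  completely_positive : ∀ (k : ℕ) (X : Matrix (Fin k × A) (Fin k × A) ℂ),
    X.PosSemidef → (ampliation toFun X).PosSemidef
  trace_preserving : ∀ X : Matrix A A ℂ, (toFun X).trace = X.trace

section

variable {A B : Type*} [Fintype A] [DecidableEq A] [Fintype B] [DecidableEq B]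

/-- A channel maps positive semidefinite matrices to positive semidefinite matrices. -/
theorem Channel.map_posSemidef (N : Channel A B) {X : Matrix A A ℂ} (hX : X.PosSemidef) :
    (N.toFun X).PosSemidef := by
  have h := N.completely_positive 1 (X.submatrix Prod.snd Prod.snd) (hX.submatrix _)
  exact h.submatrix (fun b : B => ((0 : Fin 1), b))

/-- The output state `N(ρ)`. -/
def Channel.apply (N : Channel A B) (ρ : State A) : State B where
  mat := N.toFun ρ.mat
  psd := N.map_posSemidef ρ.psd
  trace_one := by rw [N.trace_preserving, ρ.trace_one]

/-- The output state `(id_R ⊗ N)(ρ)` for a state `ρ` of `R × A`, with `R` of dimension `k`. -/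
def Channel.applyRight (N : Channel A B) {k : ℕ} (ρ : State (Fin k × A)) : State (Fin k × B) where
  mat := ampliation N.toFun ρ.mat
  psd := N.completely_positive k ρ.mat ρ.psd
  trace_one := by
    rw [← ρ.trace_one]
    simp only [Matrix.trace, Matrix.diag, Fintype.sum_prod_type]
    refine Finset.sum_congr rfl fun r _ => ?_
    exact N.trace_preserving (Matrix.of fun a a' => ρ.mat (r, a) (r, a'))

end

/-- Quantum measurements whose outcome is a real number (the estimate): positive operator valued
measures on the Borel sets of `ℝ`. A discrete family `Λ_j` with estimates `x_j` is the case
`effect E = ∑ j with x_j ∈ E, Λ_j`. -/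
structure POVM (d : Type*) [Fintype d] [DecidableEq d] where
  effect : VectorMeasure ℝ (Matrix d d ℂ)
  psd : ∀ E : Set ℝ, (effect E).PosSemidef
  total : effect Set.univ = 1

section

variable {d : Type*} [Fintype d] [DecidableEq d]

open scoped MatrixOrder in
/-- The trace of a product of positive semidefinite matrices has nonnegative real part. -/
theorem trace_mul_re_nonneg {X Y : Matrix d d ℂ} (hX : X.PosSemidef) (hY : Y.PosSemidef) :
    0 ≤ (X * Y).trace.re := by
  obtain ⟨C, rfl⟩ : ∃ C : Matrix d d ℂ, X = Cᴴ * C :=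
    CStarAlgebra.nonneg_iff_eq_star_mul_self.mp hX.nonneg
  rw [Matrix.mul_assoc, Matrix.trace_mul_comm]
  exact (Complex.nonneg_iff.mp (hY.mul_mul_conjTranspose_same C).trace_nonneg).1

/-- Born rule: the probability law `E ↦ Tr[Λ(E) ρ]` of the outcome. -/
def POVM.law (Λ : POVM d) (ρ : State d) : Measure ℝ :=
  Measure.ofMeasurable (fun E _ => ENNReal.ofReal (Λ.effect E * ρ.mat).trace.re)
    (by simp)
    (by
      intro f hf hd
      have h := Λ.effect.m_iUnion hf hd
      let L : Matrix d d ℂ →+ ℝ :=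
        { toFun := fun M => (M * ρ.mat).trace.re
          map_zero' := by simp
          map_add' := fun M M' => by simp [Matrix.add_mul, Matrix.trace_add] }
      have hL : Continuous L := by
        change Continuous fun M : Matrix d d ℂ => (M * ρ.mat).trace.re
        fun_prop
      have h' : HasSum (fun i => (Λ.effect (f i) * ρ.mat).trace.re)
          (Λ.effect (⋃ i, f i) * ρ.mat).trace.re := h.map L hL
      rw [← h'.tsum_eq]
      exact ENNReal.ofReal_tsum_of_nonneg
        (fun i => trace_mul_re_nonneg (Λ.psd (f i)) ρ.psd) h'.summable)

end

/-! ### RLD Fisher information -/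

section

variable {d : Type*} [Fintype d] [DecidableEq d]

/-- The derivative at `θ`, along the parameter set `Θ`, of a family of matrices. -/
def matDeriv {d e : Type*} (Θ : Set ℝ) (M : ℝ → Matrix d e ℂ) (θ : ℝ) : Matrix d e ℂ :=
  Matrix.of fun i j => derivWithin (fun t => M t i j) Θ θ

/-- The support of a matrix: the orthogonal complement of its kernel. -/
def supp (M : Matrix d d ℂ) : Submodule ℂ (EuclideanSpace ℂ d) :=
  (LinearMap.ker (Matrix.toEuclideanLin M))ᗮ

/-- The inverse of a Hermitian matrix taken on its support: in a spectral decomposition each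
nonzero eigenvalue is inverted and the eigenvalue zero is kept (here `(0 : ℝ)⁻¹ = 0`). -/
def suppInv (M : Matrix d d ℂ) : Matrix d d ℂ :=
  cfc (fun x : ℝ => x⁻¹) M

end

section

variable {A B : Type*} [Fintype A] [DecidableEq A] [Fintype B] [DecidableEq B]

/-- The operator `|Γ⟩⟨Γ|` of the unnormalized maximally entangled vector
`|Γ⟩ = ∑ i, |i⟩ ⊗ |i⟩`. -/
def maxEntangled (A : Type*) [DecidableEq A] : Matrix (A × A) (A × A) ℂ :=
  let Γ : A × A → ℂ := fun p => if p.1 = p.2 then 1 else 0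
  Matrix.vecMulVec Γ (star Γ)

/-- The Choi operator `(id_R ⊗ N)(|Γ⟩⟨Γ|)`, with `R` a copy of `A`. -/
def Channel.choi (N : Channel A B) : Matrix (A × B) (A × B) ℂ :=
  ampliation N.toFun (maxEntangled A)

/-- The partial trace over the second tensor factor. -/
def partialTraceRight (M : Matrix (A × B) (A × B) ℂ) : Matrix A A ℂ :=
  Matrix.of fun a a' => ∑ b, M (a, b) (a', b)

/-- The operator norm of a matrix acting on the Hilbert space `ℂ^A`. -/
def opNorm (M : Matrix A A ℂ) : ℝ :=
  ‖Matrix.toEuclideanCLM (n := A) (𝕜 := ℂ) M‖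

open Classical in
/-- RLD Fisher information at `θ` of a family of channels with parameter set `Θ`, with `Γ` the
Choi operator: `‖Tr_B[(∂Γ) Γ⁻¹ (∂Γ)]‖_∞` if `supp ∂Γ ⊆ supp Γ`, and `∞` otherwise. -/
def rldFisherChannel (Θ : Set ℝ) (N : ℝ → Channel A B) (θ : ℝ) : ℝ≥0∞ :=
  let dΓ := matDeriv Θ (fun t => (N t).choi) θ
  if supp dΓ ≤ supp (N θ).choi then
    ENNReal.ofReal (opNorm (partialTraceRight (dΓ * suppInv (N θ).choi * dΓ)))
  else ⊤

/-- The family of channels is differentiable at `θ` along `Θ`: so is each matrix entry of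
`N_t(X)`, for each operator `X`. -/
def DifferentiableFamilyAt (Θ : Set ℝ) (N : ℝ → Channel A B) (θ : ℝ) : Prop :=
  ∀ (X : Matrix A A ℂ) (b b' : B),
    DifferentiableWithinAt ℝ (fun t => (N t).toFun X b b') Θ θ

end

/-! ### Sequential estimation protocols -/

/-- Sequential (adaptive) protocols with `n ≥ 1` uses of a channel from `A` to `B`. Before use
number `i + 1` of the channel (`i = 0, …, n - 1`) the memory has dimension `mem i`; the values
`mem i` with `i ≥ n` play no role. -/
structure SequentialProtocol (A B : Type*) [Fintype A] [DecidableEq A] [Fintype B]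
    [DecidableEq B] (n : ℕ) where
  pos : 0 < n
  mem : ℕ → ℕ
  init : State (Fin (mem 0) × A)
  inter : ∀ i : ℕ, i + 1 < n → Channel (Fin (mem i) × B) (Fin (mem (i + 1)) × A)
  meas : POVM (Fin (mem (n - 1)) × B)

namespace SequentialProtocol

variable {A B : Type*} [Fintype A] [DecidableEq A] [Fintype B] [DecidableEq B] {n : ℕ}

/-- The state of memory and channel input just before use number `i + 1` of the channel `N`. -/
def stateBefore (P : SequentialProtocol A B n) (N : Channel A B) :
    ∀ i : ℕ, i < n → State (Fin (P.mem i) × A)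
  | 0, _ => P.init
  | i + 1, h => (P.inter i h).apply (N.applyRight (P.stateBefore N i (Nat.lt_of_succ_lt h)))

/-- The state of memory and channel output after the last use of the channel `N`. -/
def finalState (P : SequentialProtocol A B n) (N : Channel A B) :
    State (Fin (P.mem (n - 1)) × B) :=
  N.applyRight (P.stateBefore N (n - 1) (Nat.sub_lt P.pos Nat.one_pos))

/-- The probability law on `ℝ` of the estimate when the unknown channel is `N`. -/
def estimateLaw (P : SequentialProtocol A B n) (N : Channel A B) : Measure ℝ :=
  P.meas.law (P.finalState N)

/-- The estimate is unbiased: for each `t ∈ Θ` it is integrable with mean `t` when the unknown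
channel is `N t`. -/
def IsUnbiased (P : SequentialProtocol A B n) (Θ : Set ℝ) (N : ℝ → Channel A B) : Prop :=
  ∀ t ∈ Θ, Integrable (fun x : ℝ => x) (P.estimateLaw (N t)) ∧
    ∫ x, x ∂(P.estimateLaw (N t)) = t

/-- The variance of the estimate (possibly infinite) when the unknown channel is `N`. -/
def variance (P : SequentialProtocol A B n) (N : Channel A B) : ℝ≥0∞ :=
  evariance (fun x : ℝ => x) (P.estimateLaw N)

end SequentialProtocol

end QEst

end

/-!
The bound is a quantum Cramér–Rao inequality for the right logarithmic derivative (RLD) combined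
with the fact that the RLD Fisher information of the evolving state grows by at most
`I = rldFisherChannel Θ N θ` per use of the channel.

For a state `ω` with derivative `D`, the number `Tr[D ω⁻¹ D]` is the least `Tr Z` for which the
block matrix `[[Z, D], [D, ω]]` is positive semidefinite. The predicate `RLDBound ω D c` records
that such a `Z` with `Tr Z ≤ c` exists, and the argument never needs `ω⁻¹` itself.

* `RLDBound.map` (data processing): a parameter-independent channel, being completely positive, can
  be applied to the whole block matrix.
* `RLDBound.choiAct` (chain rule): the output state is obtained from `ρ ⊗ Γ`, with `Γ` the Choi
  operator, by contracting the input system. The tensor product of the block matrices of `(ρ, D)`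
  and `(Γ, dΓ)` compresses to a block matrix for `(ρ ⊗ Γ, D ⊗ Γ + ρ ⊗ dΓ)`. In the trace of its
  first block the mixed terms carry the factor `Tr_B dΓ = 0`, so the two bounds add, without the
  factor that a Cauchy–Schwarz estimate of the mixed terms would cost.
* `exists_posSemidef_block`: the support condition makes `[[dΓ Γ⁻¹ dΓ, dΓ], [dΓ, Γ]]` positive
  semidefinite. The operator norm of `Tr_B[dΓ Γ⁻¹ dΓ]` bounds its expectation in any input state.

Hence after `n` uses the final state satisfies `RLDBound` with `c = n I`
(`SequentialProtocol.rldBound_finalState`).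

For Hermitian `T`, positivity of the block matrix gives `Tr[T D]² ≤ c Tr[T ω T]`
(`RLDBound.sq_trace_mul_le`). With `T = ∫ (x - θ) dΛ`, the left side is `1` by unbiasedness and
`Tr[T ω T]` is at most the variance. As this operator integral need not exist, `one_le_mul_variance`
replaces it by integrals of simple functions. Their expectations converge in every state `ω t`,
hence on the span of these states, and this span contains the derivative `D`.
-/


namespace QEst

/-! ### Two-by-two block matrices and bounds on the RLD Fisher information -/

section Block

variable {d : Type*}

/-- The `(i, j)` block of a two-by-two block matrix, whose index set is `Fin 2 × d`. -/
def block (G : Matrix (Fin 2 × d) (Fin 2 × d) ℂ) (i j : Fin 2) : Matrix d d ℂ :=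
  Matrix.of fun p q => G (i, p) (j, q)

/-- `RLDBound X D c` says that `c` bounds the RLD Fisher information `Tr[D X⁻¹ D]` of a state `X`
with derivative `D`. It is expressed by the semidefinite program for this quantity: there is a
positive semidefinite block matrix `[[Z, D], [D, X]]` with `Tr Z ≤ c`. -/
def RLDBound [Fintype d] (X D : Matrix d d ℂ) (c : ℝ) : Prop :=
  ∃ G : Matrix (Fin 2 × d) (Fin 2 × d) ℂ, G.PosSemidef ∧ block G 0 1 = D ∧ block G 1 0 = D ∧
    block G 1 1 = X ∧ (block G 0 0).trace.re ≤ c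

theorem block_posSemidef {G : Matrix (Fin 2 × d) (Fin 2 × d) ℂ} (hG : G.PosSemidef) (i : Fin 2) :
    (block G i i).PosSemidef :=
  hG.submatrix fun p => (i, p)

variable [Fintype d]

/-- A parameter-independent state has vanishing RLD Fisher information. -/
theorem rldBound_zero [DecidableEq d] {X : Matrix d d ℂ} (hX : X.PosSemidef) :
    RLDBound X 0 0 := by
  -- `V` is the block row `[0, 1]`, so that `V† X V = [[0, 0], [0, X]]`.
  let V : Matrix d (Fin 2 × d) ℂ := Matrix.of fun i q => if q.1 = 1 ∧ i = q.2 then 1 else 0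
  refine ⟨Vᴴ * X * V, hX.conjTranspose_mul_mul_same V, ?_, ?_, ?_, le_of_eq ?_⟩
  · ext p q
    simp [block, Matrix.mul_apply, V]
  · ext p q
    simp [block, Matrix.mul_apply, V]
  · ext p q
    simp [block, Matrix.mul_apply, V]
  · simp [block, Matrix.mul_apply, V, Matrix.trace]

/-- Data processing: a parameter-independent channel does not increase the RLD Fisher information.
Complete positivity is used for the ancilla `Fin 2` that carries the block structure. -/
theorem RLDBound.map {e : Type*} [Fintype e] [DecidableEq d] [DecidableEq e] (S : Channel d e)
    {X D : Matrix d d ℂ} {c : ℝ} (h : RLDBound X D c) :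
    RLDBound (S.toFun X) (S.toFun D) c := by
  obtain ⟨G, hG, rfl, h10, rfl, hc⟩ := h
  refine ⟨ampliation S.toFun G, S.completely_positive 2 G hG, rfl, ?_, rfl, ?_⟩
  · rw [← h10]
    rfl
  · refine le_trans (le_of_eq ?_) hc
    rw [← S.trace_preserving]
    rfl

/-- The Cramér–Rao step: the quadratic form of the block matrix on `(s, T)` is a nonnegative
quadratic polynomial in `s`, whose discriminant is nonpositive. -/
theorem RLDBound.sq_trace_mul_le [DecidableEq d] {X D : Matrix d d ℂ} {c : ℝ}
    (h : RLDBound X D c) {T : Matrix d d ℂ} (hT : T.IsHermitian) :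
    (T * D).trace.re ^ 2 ≤ c * (T * X * T).trace.re := by
  obtain ⟨G, hG, h01, h10, h11, hc⟩ := h
  have key : ∀ s : ℝ, 0 ≤ (block G 0 0).trace.re * (s * s) + (2 * (T * D).trace.re) * s +
      (T * X * T).trace.re := by
    intro s
    -- `W` is the block column with entries `s` and `T`.
    let W : Matrix (Fin 2 × d) d ℂ :=
      Matrix.of fun p q => if p.1 = 0 then (if p.2 = q then (s : ℂ) else 0) else T p.2 q
    have hp := (Complex.nonneg_iff.mp (hG.conjTranspose_mul_mul_same W).trace_nonneg).1
    have he : Wᴴ * G * W = (s * s : ℂ) • block G 0 0 + (s : ℂ) • (T * D) + (s : ℂ) • (D * T) +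
        T * X * T := by
      rw [← h11]
      nth_rewrite 1 [← h10]
      rw [← h01]
      ext p q
      have hT' : ∀ i j, star (T i j) = T j i := fun i j => hT.apply j i
      simp only [Matrix.mul_apply, Fintype.sum_prod_type, Fin.sum_univ_two, W, block,
        conjTranspose_apply, of_apply, Matrix.add_apply, Matrix.smul_apply, smul_eq_mul,
        apply_ite star, hT', star_zero]
      simp [Finset.sum_add_distrib, Finset.mul_sum, add_mul, Finset.sum_mul]
      simp only [mul_comm, mul_left_comm]
      ring
    rw [he] at hp
    simp only [Matrix.trace_add, Matrix.trace_smul, Matrix.trace_mul_comm D T, smul_eq_mul,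
      Complex.add_re, ← Complex.ofReal_mul, Complex.re_ofReal_mul] at hp
    linarith
  have hd := discrim_le_zero key
  have hX : 0 ≤ (T * X * T).trace.re := by
    have := block_posSemidef hG 1
    rw [h11] at this
    have := this.conjTranspose_mul_mul_same T
    rw [hT.eq] at this
    exact (Complex.nonneg_iff.mp this.trace_nonneg).1
  have := mul_le_mul_of_nonneg_right hc hX
  simp only [discrim] at hd
  nlinarith

end Block

/-! ### The action of a Choi operator -/

section Choi

/-- The action of `id_R ⊗ N` on operators, in terms of the Choi operator `Q` of `N`. -/
def choiAct {R A B : Type*} [Fintype A] (Q : Matrix (A × B) (A × B) ℂ)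
    (X : Matrix (R × A) (R × A) ℂ) : Matrix (R × B) (R × B) ℂ :=
  Matrix.of fun p q => ∑ a, ∑ a', X (p.1, a) (q.1, a') * Q (a, p.2) (a', q.2)

variable {R A B : Type*} [Fintype A] [Fintype B]

theorem Channel.choi_apply [DecidableEq A] [DecidableEq B] (N : Channel A B) (a a' : A)
    (b b' : B) : N.choi (a, b) (a', b') = N.toFun (Matrix.single a a' 1) b b' := by
  simp only [Channel.choi, ampliation, of_apply]
  refine congrFun (congrFun (congrArg N.toFun ?_) b) b'
  ext x x'
  by_cases h : a = x <;> by_cases h' : a' = x' <;>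
    simp [maxEntangled, vecMulVec_apply, h, h']

theorem Channel.toFun_apply [DecidableEq A] [DecidableEq B] (N : Channel A B) (X : Matrix A A ℂ)
    (b b' : B) : N.toFun X b b' = ∑ a, ∑ a', X a a' * N.choi (a, b) (a', b') := by
  conv_lhs => rw [Matrix.matrix_eq_sum_single X]
  simp only [map_sum, Matrix.sum_apply, Channel.choi_apply]
  refine Finset.sum_congr rfl fun a _ => Finset.sum_congr rfl fun a' _ => ?_
  have : Matrix.single a a' (X a a') = X a a' • Matrix.single a a' (1 : ℂ) := by simp
  rw [this, map_smul]
  simp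

theorem Channel.ampliation_eq_choiAct [DecidableEq A] [DecidableEq B] (N : Channel A B)
    (X : Matrix (R × A) (R × A) ℂ) : ampliation N.toFun X = choiAct N.choi X := by
  ext p q
  simp [ampliation, choiAct, N.toFun_apply]

theorem Channel.partialTraceRight_choi [DecidableEq A] [DecidableEq B] (N : Channel A B) :
    partialTraceRight N.choi = 1 := by
  ext a a'
  simp only [partialTraceRight, of_apply, Channel.choi_apply]
  change (N.toFun (Matrix.single a a' 1)).trace = _
  rw [N.trace_preserving]
  by_cases h : a = a'
  · subst h; simp
  · simp [h]

variable [Fintype R]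

theorem trace_choiAct (Q : Matrix (A × B) (A × B) ℂ) (X : Matrix (R × A) (R × A) ℂ) :
    (choiAct Q X).trace =
      ∑ r, ((Matrix.of fun a a' => X (r, a) (r, a')) * (partialTraceRight Q)ᵀ).trace := by
  simp only [Matrix.trace, diag, choiAct, Fintype.sum_prod_type, of_apply, Matrix.mul_apply,
    transpose_apply, partialTraceRight, Finset.mul_sum]
  refine Finset.sum_congr rfl fun r _ => ?_
  rw [Finset.sum_comm]
  refine Finset.sum_congr rfl fun a _ => ?_
  rw [Finset.sum_comm]

theorem trace_choiAct_of_partialTraceRight_eq_one [DecidableEq A] {Q : Matrix (A × B) (A × B) ℂ}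
    (hQ : partialTraceRight Q = 1) (X : Matrix (R × A) (R × A) ℂ) :
    (choiAct Q X).trace = X.trace := by
  rw [trace_choiAct, hQ]
  simp [Matrix.trace, Fintype.sum_prod_type]

theorem trace_choiAct_of_partialTraceRight_eq_zero {Q : Matrix (A × B) (A × B) ℂ}
    (hQ : partialTraceRight Q = 0) (X : Matrix (R × A) (R × A) ℂ) :
    (choiAct Q X).trace = 0 := by
  rw [trace_choiAct, hQ]
  simp

/-- Summing out an index pair with weights on each side is a congruence, hence preserves
positive semidefiniteness. -/
theorem posSemidef_contract {p u : Type*} [Fintype p] [Fintype u] [DecidableEq p]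
    {M : Matrix (p × u) (p × u) ℂ} (hM : M.PosSemidef) (c : p → u → ℂ) :
    (Matrix.of fun i j => ∑ x, ∑ y, star (c i x) * M (i, x) (j, y) * c j y).PosSemidef := by
  let C : Matrix (p × u) p ℂ := Matrix.of fun k i => if k.1 = i then c i k.2 else 0
  have : (Matrix.of fun i j => ∑ x, ∑ y, star (c i x) * M (i, x) (j, y) * c j y) =
      Cᴴ * M * C := by
    ext i j
    simp only [of_apply, Matrix.mul_apply, conjTranspose_apply, C, Fintype.sum_prod_type,
      apply_ite star, star_zero, ite_mul, zero_mul, mul_ite, mul_zero, Finset.sum_ite_irrel,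
      Finset.sum_const_zero, Finset.sum_ite_eq', Finset.mem_univ, if_true, Finset.sum_mul]
    exact Finset.sum_comm
  rw [this]
  exact hM.conjTranspose_mul_mul_same C

/-- The chain rule for the RLD Fisher information. If the block matrix `[[Z, dΓ], [dΓ, Γ]]` of
Choi operators is positive semidefinite, `Tr_B Γ = 1` and `Tr_B dΓ = 0`, then an application of the
channel with Choi operator `Γ` increases the Fisher information of a state by at most `k`, where
`Tr_B Z` is bounded by `k` in the sense of `hk`. -/
theorem RLDBound.choiAct [DecidableEq A] [DecidableEq B] [DecidableEq R]
    {X D : Matrix (R × A) (R × A) ℂ}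
    {c k : ℝ} (h : RLDBound X D c) {Q : Matrix (Fin 2 × (A × B)) (Fin 2 × (A × B)) ℂ}
    (hQ : Q.PosSemidef) (hQs : block Q 1 0 = block Q 0 1)
    (hQ1 : partialTraceRight (block Q 1 1) = 1) (hQ0 : partialTraceRight (block Q 0 1) = 0)
    (hk : ∀ Y : Matrix A A ℂ, Y.PosSemidef →
      (Y * (partialTraceRight (block Q 0 0))ᵀ).trace.re ≤ k * Y.trace.re)
    (hX : X.trace = 1) :
    RLDBound (choiAct (block Q 1 1) X)
      (choiAct (block Q 1 1) D + choiAct (block Q 0 1) X) (c + k) := by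
  obtain ⟨P, hP, h01, h10, h11, hc⟩ := h
  have hXp : X.PosSemidef := h11 ▸ block_posSemidef hP 1
  -- The tensor product `P ⊗ Q` has blocks indexed by `Fin 2 × Fin 2`. It is compressed to the
  -- span of `e₀ ⊗ e₁ + e₁ ⊗ e₀` and `e₁ ⊗ e₁`, which implements the product rule, while the
  -- two copies of `A` are contracted.
  let w : Fin 2 → Fin 2 → Fin 2 → ℂ := ![![![0, 1], ![1, 0]], ![![0, 0], ![0, 1]]]
  let e : ((Fin 2 × (R × B)) × (Fin 2 × Fin 2 × A)) →
      (Fin 2 × (R × A)) × (Fin 2 × (A × B)) :=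
    fun x => ((x.2.1, (x.1.2.1, x.2.2.2)), (x.2.2.1, (x.2.2.2, x.1.2.2)))
  have hG := posSemidef_contract ((hP.kronecker hQ).submatrix e) fun p u => w p.1 u.1 u.2.1
  refine ⟨_, hG, ?_, ?_, ?_, ?_⟩
  · rw [← h01, ← h11]
    ext p q
    simp [block, QEst.choiAct, Fintype.sum_prod_type, e, w, Fin.sum_univ_two,
      Finset.sum_add_distrib]
    exact add_comm _ _
  · rw [← h10, ← h11, ← hQs]
    ext p q
    simp [block, QEst.choiAct, Fintype.sum_prod_type, e, w, Fin.sum_univ_two,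
      Finset.sum_add_distrib]
    exact add_comm _ _
  · rw [← h11]
    ext p q
    simp [block, QEst.choiAct, Fintype.sum_prod_type, e, w, Fin.sum_univ_two,
      Finset.sum_add_distrib]
  · have hZ : (block (Matrix.of fun i j => ∑ x, ∑ y, star (w i.1 x.1 x.2.1) *
        (kroneckerMap (· * ·) P Q).submatrix e e (i, x) (j, y) * w j.1 y.1 y.2.1) 0 0) =
        QEst.choiAct (block Q 1 1) (block P 0 0) + QEst.choiAct (block Q 1 0) (block P 0 1) +
        QEst.choiAct (block Q 0 1) (block P 1 0) + QEst.choiAct (block Q 0 0) (block P 1 1) := by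
      ext p q
      simp [block, QEst.choiAct, Fintype.sum_prod_type, e, w, Fin.sum_univ_two,
        Finset.sum_add_distrib]
      ring
    rw [hZ]
    simp only [trace_add, hQs, trace_choiAct_of_partialTraceRight_eq_zero hQ0,
      trace_choiAct_of_partialTraceRight_eq_one hQ1, h11, add_zero, Complex.add_re]
    refine add_le_add hc ?_
    rw [trace_choiAct, Complex.re_sum]
    calc _ ≤ ∑ r, k * (Matrix.of fun a a' => X (r, a) (r, a')).trace.re :=
          Finset.sum_le_sum fun r _ => hk _ (hXp.submatrix fun a => (r, a))
      _ = k * X.trace.re := by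
          rw [← Finset.mul_sum, ← Complex.re_sum]
          simp [Matrix.trace, Fintype.sum_prod_type]
      _ = k := by simp [hX]

end Choi

/-! ### The block matrix of a channel family -/

section Family

variable {d : Type*} [Fintype d] [DecidableEq d]

theorem mul_suppInv_mul_self {M : Matrix d d ℂ} (hM : M.IsHermitian) : M * suppInv M * M = M := by
  have hs : IsSelfAdjoint M := hM
  have hf : ∀ f : ℝ → ℝ, ContinuousOn f (spectrum ℝ M) := fun f =>
    (Matrix.finite_real_spectrum (A := M)).continuousOn f
  calc M * suppInv M * M
      = cfc (fun x : ℝ => x) M * cfc (fun x : ℝ => x⁻¹) M * cfc (fun x : ℝ => x) M := by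
        rw [cfc_id' ℝ M, suppInv]
    _ = cfc (fun x : ℝ => x * x⁻¹ * x) M := by
        rw [← cfc_mul _ _ M (hf _) (hf _), ← cfc_mul _ _ M (hf _) (hf _)]
    _ = M := by
        simp only [mul_inv_mul_cancel]
        exact cfc_id' ℝ M

theorem suppInv_isHermitian (M : Matrix d d ℂ) : (suppInv M).IsHermitian :=
  cfc_predicate (R := ℝ) _ M

/-- If the support of `D` lies in that of `M`, then `D` annihilates the complement of the support
of `M`. -/
theorem mul_suppInv_mul_of_supp_le {M D : Matrix d d ℂ} (hM : M.IsHermitian)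
    (h : supp D ≤ supp M) : D * suppInv M * M = D := by
  have hker : LinearMap.ker (Matrix.toEuclideanLin M) ≤
      LinearMap.ker (Matrix.toEuclideanLin D) := by
    have := Submodule.orthogonal_le h
    simpa [supp] using this
  have h0 : M * (1 - suppInv M * M) = 0 := by
    rw [mul_sub, mul_one, ← mul_assoc, mul_suppInv_mul_self hM, sub_self]
  have hD : D * (1 - suppInv M * M) = 0 := by
    refine Matrix.ext_of_mulVec_single fun i => ?_
    have hv : WithLp.toLp 2 ((1 - suppInv M * M) *ᵥ Pi.single i 1) ∈
        LinearMap.ker (Matrix.toEuclideanLin M) := by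
      rw [LinearMap.mem_ker, Matrix.toLpLin_toLp]
      simp only [toLin'_apply, mulVec_mulVec, h0, zero_mulVec]
      rfl
    have := hker hv
    rw [LinearMap.mem_ker, Matrix.toLpLin_toLp] at this
    simp only [toLin'_apply, mulVec_mulVec] at this
    have h' := congrArg WithLp.ofLp this
    rw [zero_mulVec]
    exact h'
  rw [mul_sub, mul_one, ← mul_assoc, sub_eq_zero] at hD
  exact hD.symm

/-- The block matrix `[[D M⁻¹ D, D], [D, M]]`, with the inverse taken on the support, is positive
semidefinite when the support of `D` lies in that of `M`: it is `V† M V` for the block row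
`V = [M⁻¹ D, 1]`. -/
theorem exists_posSemidef_block {M D : Matrix d d ℂ} (hM : M.PosSemidef) (hD : D.IsHermitian)
    (h : supp D ≤ supp M) :
    ∃ Q : Matrix (Fin 2 × d) (Fin 2 × d) ℂ, Q.PosSemidef ∧ block Q 0 1 = D ∧ block Q 1 0 = D ∧
      block Q 1 1 = M ∧ block Q 0 0 = D * suppInv M * D := by
  have h1 := mul_suppInv_mul_of_supp_le hM.1 h
  have h2 : M * (suppInv M * D) = D := by
    have := congrArg conjTranspose h1
    rwa [conjTranspose_mul, conjTranspose_mul, hD.eq, hM.1.eq, (suppInv_isHermitian M).eq] at this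
  let V : Matrix d (Fin 2 × d) ℂ :=
    Matrix.of fun i q => if q.1 = 0 then (suppInv M * D) i q.2 else (1 : Matrix d d ℂ) i q.2
  have hcol : ∀ j : Fin 2, ∀ x y, (Vᴴ * M * V) x (j, y) =
      (Vᴴ * M * (if j = 0 then suppInv M * D else 1)) x y := by
    intro j x y
    rw [Matrix.mul_apply, Matrix.mul_apply]
    refine Finset.sum_congr rfl fun i _ => ?_
    by_cases hj : j = 0 <;> simp [V, hj]
  have hrow : ∀ (i : Fin 2) (x y) (Y : Matrix d d ℂ), (Vᴴ * Y) (i, x) y =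
      ((if i = 0 then suppInv M * D else 1)ᴴ * Y) x y := by
    intro i x y Y
    rw [Matrix.mul_apply, Matrix.mul_apply]
    refine Finset.sum_congr rfl fun k _ => ?_
    by_cases hi : i = 0 <;> simp [V, hi]
  have hb : ∀ i j, block (Vᴴ * M * V) i j =
      (if i = 0 then suppInv M * D else 1)ᴴ * (M * (if j = 0 then suppInv M * D else 1)) := by
    intro i j
    ext x y
    simp only [block, of_apply]
    rw [hcol, Matrix.mul_assoc, hrow]
  have hc : (suppInv M * D)ᴴ = D * suppInv M := by
    rw [conjTranspose_mul, hD.eq, (suppInv_isHermitian M).eq]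
  refine ⟨Vᴴ * M * V, hM.conjTranspose_mul_mul_same V, ?_, ?_, ?_, ?_⟩
  · simp [hb, hc, h1]
  · simp [hb, h2]
  · simp [hb]
  · simp [hb, hc, h2]

theorem isHermitian_partialTraceRight {A B : Type*} [Fintype B] {M : Matrix (A × B) (A × B) ℂ}
    (hM : M.IsHermitian) : (partialTraceRight M).IsHermitian := by
  ext a a'
  simp only [partialTraceRight, conjTranspose_apply, of_apply, star_sum]
  exact Finset.sum_congr rfl fun b _ => hM.apply _ _

/-- For a Hermitian `K`, the matrix `‖K‖ - K` is positive semidefinite. -/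
theorem posSemidef_opNorm_smul_one_sub {K : Matrix d d ℂ} (hK : K.IsHermitian) :
    ((opNorm K : ℂ) • (1 : Matrix d d ℂ) - K).PosSemidef := by
  have hH : ((opNorm K : ℂ) • (1 : Matrix d d ℂ) - K).IsHermitian := by
    refine IsHermitian.sub ?_ hK
    simp [IsHermitian, conjTranspose_smul]
  refine PosSemidef.of_dotProduct_mulVec_nonneg hH fun x => ?_
  rw [Complex.nonneg_iff]
  refine ⟨?_, ?_⟩
  · set v : EuclideanSpace ℂ d := WithLp.toLp 2 x
    have h1 : star x ⬝ᵥ (K *ᵥ x) = inner ℂ v (Matrix.toEuclideanCLM (n := d) (𝕜 := ℂ) K v) := by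
      simp [v, EuclideanSpace.inner_eq_star_dotProduct, dotProduct_comm]
    have h2 : star x ⬝ᵥ x = ((‖v‖ ^ 2 : ℝ) : ℂ) := by
      have := inner_self_eq_norm_sq_to_K (𝕜 := ℂ) v
      rw [EuclideanSpace.inner_eq_star_dotProduct] at this
      simpa [v, dotProduct_comm] using this
    rw [sub_mulVec, dotProduct_sub, smul_mulVec, one_mulVec, dotProduct_smul, h1, h2,
      smul_eq_mul, ← Complex.ofReal_mul, Complex.sub_re, Complex.ofReal_re, sub_nonneg]
    calc _ ≤ ‖inner ℂ v (Matrix.toEuclideanCLM (n := d) (𝕜 := ℂ) K v)‖ := Complex.re_le_norm _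
      _ ≤ ‖v‖ * ‖Matrix.toEuclideanCLM (n := d) (𝕜 := ℂ) K v‖ := norm_inner_le_norm _ _
      _ ≤ ‖v‖ * (opNorm K * ‖v‖) := by
          gcongr
          exact ContinuousLinearMap.le_opNorm _ _
      _ = _ := by ring
  · exact (hH.im_star_dotProduct_mulVec_self x).symm

/-- The transpose is the one that appears when a Choi operator acts on the state `Y`. -/
theorem trace_mul_transpose_le_opNorm {K Y : Matrix d d ℂ} (hK : K.IsHermitian)
    (hY : Y.PosSemidef) : (Y * Kᵀ).trace.re ≤ opNorm K * Y.trace.re := by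
  have h := trace_mul_re_nonneg hY (posSemidef_opNorm_smul_one_sub hK).transpose
  rw [transpose_sub, transpose_smul, transpose_one, mul_sub, Matrix.mul_smul, mul_one, trace_sub,
    trace_smul, Complex.sub_re, smul_eq_mul, Complex.re_ofReal_mul] at h
  linarith

end Family

/-! ### Measurement statistics and the quantum Cramér–Rao bound -/

section Measurement

variable {d : Type*} [Fintype d] [DecidableEq d]

theorem POVM.law_apply (Λ : POVM d) (ρ : State d) {E : Set ℝ} (hE : MeasurableSet E) :
    Λ.law ρ E = ENNReal.ofReal (Λ.effect E * ρ.mat).trace.re :=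
  Measure.ofMeasurable_apply E hE

theorem POVM.law_real_apply (Λ : POVM d) (ρ : State d) {E : Set ℝ} (hE : MeasurableSet E) :
    (Λ.law ρ).real E = (Λ.effect E * ρ.mat).trace.re := by
  rw [Measure.real, Λ.law_apply ρ hE, ENNReal.toReal_ofReal]
  exact trace_mul_re_nonneg (Λ.psd E) ρ.psd

instance POVM.isProbabilityMeasure_law (Λ : POVM d) (ρ : State d) :
    IsProbabilityMeasure (Λ.law ρ) where
  measure_univ := by
    rw [Λ.law_apply ρ MeasurableSet.univ, Λ.total, one_mul, ρ.trace_one]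
    simp

/-- The operator `∫ f dΛ` of a simple function `f`. -/
noncomputable def POVM.integralSimple (Λ : POVM d) (f : SimpleFunc ℝ ℝ) : Matrix d d ℂ :=
  ∑ y ∈ f.range, (y : ℂ) • Λ.effect (f ⁻¹' {y})

theorem POVM.integralSimple_isHermitian (Λ : POVM d) (f : SimpleFunc ℝ ℝ) :
    (Λ.integralSimple f).IsHermitian := by
  simp only [IsHermitian, POVM.integralSimple, conjTranspose_sum, conjTranspose_smul,
    (Λ.psd _).1.eq]
  simp

theorem POVM.sum_effect_preimage (Λ : POVM d) (f : SimpleFunc ℝ ℝ) :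
    ∑ y ∈ f.range, Λ.effect (f ⁻¹' {y}) = 1 := by
  rw [← VectorMeasure.of_biUnion_finset, ← Λ.total]
  · congr 1
    ext x
    simp
  · intro x _ y _ hxy
    exact Disjoint.preimage _ (Set.disjoint_singleton.mpr hxy)
  · exact fun y _ => f.measurableSet_fiber y

theorem POVM.integral_comp_simpleFunc (Λ : POVM d) (ρ : State d) (f : SimpleFunc ℝ ℝ) (g : ℝ → ℝ)
    (hg : g 0 = 0) :
    ∫ x, g (f x) ∂(Λ.law ρ) = ∑ y ∈ f.range, g y * (Λ.effect (f ⁻¹' {y}) * ρ.mat).trace.re := by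
  have h := SimpleFunc.map_integral (μ := Λ.law ρ) f g (SimpleFunc.integrable_of_isFiniteMeasure f)
    hg
  rw [SimpleFunc.integral_eq_integral _ (SimpleFunc.integrable_of_isFiniteMeasure _)] at h
  simp only [SimpleFunc.coe_map, Function.comp_apply] at h
  rw [h]
  refine Finset.sum_congr rfl fun y _ => ?_
  rw [Λ.law_real_apply ρ (f.measurableSet_fiber y), smul_eq_mul, mul_comm]

theorem POVM.trace_integralSimple_mul (Λ : POVM d) (ρ : State d) (f : SimpleFunc ℝ ℝ) :
    (Λ.integralSimple f * ρ.mat).trace.re = ∫ x, f x ∂(Λ.law ρ) := by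
  rw [Λ.integral_comp_simpleFunc ρ f (fun y => y) rfl]
  simp only [POVM.integralSimple, Finset.sum_mul, trace_sum, Complex.re_sum, smul_mul_assoc,
    trace_smul, smul_eq_mul, Complex.re_ofReal_mul]

/-- The operator inequality `(∫ f dΛ)² ≤ ∫ f² dΛ`, in expectation: the difference of the two sides
is `∫ (f - T) dΛ (f - T)` with `T = ∫ f dΛ`. -/
theorem POVM.trace_integralSimple_sq_le (Λ : POVM d) (ρ : State d) (f : SimpleFunc ℝ ℝ) :
    (Λ.integralSimple f * ρ.mat * Λ.integralSimple f).trace.re ≤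
      ∫ x, (f x) ^ 2 ∂(Λ.law ρ) := by
  rw [Λ.integral_comp_simpleFunc ρ f (fun y => y ^ 2) (by simp)]
  set T := Λ.integralSimple f with hT
  have hTh : T.IsHermitian := Λ.integralSimple_isHermitian f
  have hid : ∑ y ∈ f.range, (((y : ℂ) • (1 : Matrix d d ℂ) - T) * Λ.effect (f ⁻¹' {y}) *
      ((y : ℂ) • (1 : Matrix d d ℂ) - T)) =
      (∑ y ∈ f.range, ((y : ℂ) ^ 2) • Λ.effect (f ⁻¹' {y})) - T * T := by
    have h1 : ∀ y : ℝ, ((y : ℂ) • (1 : Matrix d d ℂ) - T) * Λ.effect (f ⁻¹' {y}) *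
        ((y : ℂ) • (1 : Matrix d d ℂ) - T) = ((y : ℂ) ^ 2) • Λ.effect (f ⁻¹' {y}) -
          ((y : ℂ) • Λ.effect (f ⁻¹' {y})) * T - T * ((y : ℂ) • Λ.effect (f ⁻¹' {y})) +
          T * Λ.effect (f ⁻¹' {y}) * T := by
      intro y
      simp only [sub_mul, mul_sub, smul_mul_assoc, mul_smul_comm, one_mul, mul_one, smul_smul, sq,
        smul_sub]
      abel
    simp only [h1, Finset.sum_add_distrib, Finset.sum_sub_distrib, ← Finset.sum_mul,
      ← Finset.mul_sum, Λ.sum_effect_preimage]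
    rw [← POVM.integralSimple, ← hT, mul_one]
    abel
  have hnn : 0 ≤ ∑ y ∈ f.range, ((((y : ℂ) • (1 : Matrix d d ℂ) - T) * Λ.effect (f ⁻¹' {y}) *
      ((y : ℂ) • (1 : Matrix d d ℂ) - T)) * ρ.mat).trace.re := by
    refine Finset.sum_nonneg fun y _ => trace_mul_re_nonneg ?_ ρ.psd
    have := (Λ.psd (f ⁻¹' {y})).conjTranspose_mul_mul_same ((y : ℂ) • (1 : Matrix d d ℂ) - T)
    rwa [conjTranspose_sub, hTh.eq, conjTranspose_smul, conjTranspose_one, Complex.star_def,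
      Complex.conj_ofReal] at this
  rw [← Complex.re_sum, ← trace_sum, ← Finset.sum_mul, hid, sub_mul, trace_sub, Complex.sub_re,
    sub_nonneg, Finset.sum_mul, trace_sum, Complex.re_sum] at hnn
  rw [trace_mul_comm, ← mul_assoc]
  refine hnn.trans (le_of_eq (Finset.sum_congr rfl fun y _ => ?_))
  rw [smul_mul_assoc, trace_smul, smul_eq_mul, ← Complex.ofReal_pow, Complex.re_ofReal_mul]

/-- Entrywise derivative, along `Θ`, of a family of matrices. -/
def HasMatDeriv {m n : Type*} (Θ : Set ℝ) (M : ℝ → Matrix m n ℂ) (D : Matrix m n ℂ) (θ : ℝ) :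
    Prop :=
  ∀ i j, HasDerivWithinAt (fun t => M t i j) (D i j) Θ θ

/-- The quantum Cramér–Rao bound for the RLD Fisher information. The estimate need not be
integrable against `Λ` itself, so `∫ (x - θ) dΛ` is approximated by operators `T k` of simple
functions. The expectations of `T k` converge on the span of the states `ω t`, which is closed and
so contains the derivative `D`. -/
theorem one_le_mul_variance (Λ : POVM d) {Θ : Set ℝ} {ω : ℝ → State d} {θ : ℝ} (hθ : θ ∈ Θ)
    (hacc : AccPt θ (𝓟 Θ)) {D : Matrix d d ℂ} (hD : HasMatDeriv Θ (fun t => (ω t).mat) D θ)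
    (hunb : ∀ t ∈ Θ, Integrable (fun x : ℝ => x) (Λ.law (ω t)) ∧ ∫ x, x ∂(Λ.law (ω t)) = t)
    {c : ℝ} (hc : RLDBound (ω θ).mat D c)
    (hvar : MemLp (fun x : ℝ => x) 2 (Λ.law (ω θ))) :
    1 ≤ c * variance (fun x : ℝ => x) (Λ.law (ω θ)) := by
  have hmeas : Measurable fun x : ℝ => x - θ := measurable_id.sub_const θ
  let f : ℕ → SimpleFunc ℝ ℝ := SimpleFunc.approxOn (fun x => x - θ) hmeas Set.univ 0 trivial
  have hf_lim : ∀ x, Tendsto (fun k => f k x) atTop (𝓝 (x - θ)) := fun x =>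
    SimpleFunc.tendsto_approxOn hmeas (Set.mem_univ 0) (by simp)
  have hf_bd : ∀ k x, |f k x| ≤ 2 * |x - θ| := by
    intro k x
    have h := SimpleFunc.edist_approxOn_y0_le hmeas (s := Set.univ) (y₀ := 0) trivial x k
    rw [edist_dist, edist_dist, ← ENNReal.ofReal_add dist_nonneg dist_nonneg,
      ENNReal.ofReal_le_ofReal_iff (by positivity), Real.dist_eq, Real.dist_eq, zero_sub, zero_sub,
      abs_neg, abs_neg] at h
    linarith
  let T : ℕ → Matrix d d ℂ := fun k => Λ.integralSimple (f k)
  have hint : ∀ t ∈ Θ, Tendsto (fun k => (T k * (ω t).mat).trace.re) atTop (𝓝 (t - θ)) := by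
    intro t ht
    obtain ⟨hi, hm⟩ := hunb t ht
    have hi' : Integrable (fun x : ℝ => x - θ) (Λ.law (ω t)) := hi.sub (integrable_const θ)
    have he : ∫ x, (x - θ) ∂(Λ.law (ω t)) = t - θ := by
      rw [integral_sub hi (integrable_const θ), hm]
      simp
    simp only [T, POVM.trace_integralSimple_mul]
    rw [← he]
    refine tendsto_integral_of_dominated_convergence (fun x => 2 * |x - θ|)
      (fun k => (f k).aestronglyMeasurable) (hi'.abs.const_mul 2)
      (fun k => Eventually.of_forall fun x => hf_bd k x) (Eventually.of_forall hf_lim)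
  let S : Submodule ℝ ((d → d → ℂ) × ℝ) :=
    { carrier := {z | Tendsto (fun k => (T k * Matrix.of z.1).trace.re) atTop (𝓝 z.2)}
      add_mem' := by
        intro z w hz hw
        have := Tendsto.add hz hw
        simpa [← of_add_of, mul_add, trace_add] using this
      zero_mem' := by
        have : (Matrix.of (0 : d → d → ℂ)) = 0 := rfl
        simp [this]
      smul_mem' := by
        intro r z hz
        have h := Tendsto.const_mul r hz
        have he : ∀ k, (T k * Matrix.of (r • z.1)).trace.re =
            r * (T k * Matrix.of z.1).trace.re := by
          intro k
          rw [← smul_of, mul_smul_comm, trace_smul, Complex.smul_re, smul_eq_mul]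
        simpa [he] using h }
  let F : ℝ → (d → d → ℂ) × ℝ := fun t => (fun i j => (ω t).mat i j, t - θ)
  have hF : HasDerivWithinAt F ((fun i j => D i j), 1) Θ θ := by
    refine HasDerivWithinAt.prodMk ?_ ((hasDerivWithinAt_id θ Θ).sub_const θ)
    rw [hasDerivWithinAt_pi]
    intro i
    rw [hasDerivWithinAt_pi]
    exact fun j => hD i j
  have hmem : ((fun i j => D i j), (1 : ℝ)) ∈ Submodule.span ℝ (F '' Θ) := by
    have h1 := range_derivWithin_subset_closure_span_image F (s := Θ) (t := Θ)
      (by simpa using subset_closure) ⟨θ, rfl⟩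
    rw [hF.derivWithin (uniqueDiffWithinAt_iff_accPt.mpr hacc)] at h1
    rwa [IsClosed.closure_eq (Submodule.closed_of_finiteDimensional _)] at h1
  have hspan : Submodule.span ℝ (F '' Θ) ≤ S := by
    rw [Submodule.span_le]
    rintro _ ⟨t, ht, rfl⟩
    exact hint t ht
  have hlim : Tendsto (fun k => (T k * D).trace.re) atTop (𝓝 1) := hspan hmem
  have hmean : ∫ x, x ∂(Λ.law (ω θ)) = θ := (hunb θ hθ).2
  have hL2 : Integrable (fun x : ℝ => (x - θ) ^ 2) (Λ.law (ω θ)) :=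
    (hvar.sub (memLp_const θ)).integrable_sq
  have hlim2 : Tendsto (fun k => ∫ x, (f k x) ^ 2 ∂(Λ.law (ω θ))) atTop
      (𝓝 (∫ x, (x - θ) ^ 2 ∂(Λ.law (ω θ)))) := by
    refine tendsto_integral_of_dominated_convergence (fun x => 4 * (x - θ) ^ 2)
      (fun k => ((f k).aestronglyMeasurable).pow 2) (hL2.const_mul 4)
      (fun k => Eventually.of_forall fun x => ?_)
      (Eventually.of_forall fun x => (hf_lim x).pow 2)
    rw [norm_pow, Real.norm_eq_abs]
    calc |f k x| ^ 2 ≤ (2 * |x - θ|) ^ 2 := pow_le_pow_left₀ (abs_nonneg _) (hf_bd k x) 2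
      _ = 4 * (x - θ) ^ 2 := by rw [mul_pow, sq_abs]; norm_num
  have hc0 : 0 ≤ c := by
    obtain ⟨G, hG, -, -, -, h⟩ := hc
    exact (Complex.nonneg_iff.mp (block_posSemidef hG 0).trace_nonneg).1.trans h
  have hfin := le_of_tendsto_of_tendsto' (hlim.pow 2) (hlim2.const_mul c) fun k =>
    (hc.sq_trace_mul_le (Λ.integralSimple_isHermitian (f k))).trans
      (mul_le_mul_of_nonneg_left (Λ.trace_integralSimple_sq_le (ω θ) (f k)) hc0)
  rw [variance_eq_integral (X := fun x : ℝ => x) measurable_id.aemeasurable, hmean]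
  simpa using hfin

end Measurement

/-! ### Fisher information along a sequential protocol -/

section Sequential

variable {A B : Type*} [Fintype A]

/-- The product rule for the output of a varying channel on a varying input. -/
theorem HasMatDeriv.choiAct {R : Type*} {Θ : Set ℝ} {θ : ℝ} {Q : ℝ → Matrix (A × B) (A × B) ℂ}
    {dQ : Matrix (A × B) (A × B) ℂ} {X : ℝ → Matrix (R × A) (R × A) ℂ}
    {D : Matrix (R × A) (R × A) ℂ} (hQ : HasMatDeriv Θ Q dQ θ) (hX : HasMatDeriv Θ X D θ) :
    HasMatDeriv Θ (fun t => choiAct (Q t) (X t)) (choiAct (Q θ) D + choiAct dQ (X θ)) θ := by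
  intro p q
  simp only [QEst.choiAct, of_apply, Matrix.add_apply, ← Finset.sum_add_distrib]
  exact HasDerivWithinAt.fun_sum fun a _ => HasDerivWithinAt.fun_sum fun a' _ =>
    (hX _ _).mul (hQ _ _)

variable [DecidableEq A] [Fintype B] [DecidableEq B]

theorem HasMatDeriv.toFun (S : Channel A B) {Θ : Set ℝ} {θ : ℝ} {X : ℝ → Matrix A A ℂ}
    {D : Matrix A A ℂ} (hX : HasMatDeriv Θ X D θ) :
    HasMatDeriv Θ (fun t => S.toFun (X t)) (S.toFun D) θ := by
  intro b b'
  simp only [S.toFun_apply]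
  exact HasDerivWithinAt.fun_sum fun a _ => HasDerivWithinAt.fun_sum fun a' _ =>
    (hX _ _).mul_const _

theorem hasMatDeriv_choi {Θ : Set ℝ} {N : ℝ → Channel A B} {θ : ℝ}
    (hN : DifferentiableFamilyAt Θ N θ) :
    HasMatDeriv Θ (fun t => (N t).choi) (matDeriv Θ (fun t => (N t).choi) θ) θ :=
  fun p q => (hN (Matrix.of fun a a' => maxEntangled A (p.1, a) (q.1, a')) p.2
    q.2).hasDerivWithinAt

/-- Complete positivity is assumed for ancillas `Fin k`, so the reference copy of `A` is
reindexed. -/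
theorem Channel.choi_posSemidef (N : Channel A B) : N.choi.PosSemidef := by
  have hp : (maxEntangled A).PosSemidef := posSemidef_vecMulVec_self_star _
  let e := Fintype.equivFin A
  have h := N.completely_positive (Fintype.card A)
    ((maxEntangled A).submatrix (fun p => (e.symm p.1, p.2)) fun p => (e.symm p.1, p.2))
    (hp.submatrix _)
  have h' := h.submatrix fun p : A × B => (e p.1, p.2)
  convert h' using 1
  ext p q
  simp [Channel.choi, ampliation]

theorem HasMatDeriv.isHermitian {d : Type*} {Θ : Set ℝ} {θ : ℝ} (hacc : AccPt θ (𝓟 Θ))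
    {M : ℝ → Matrix d d ℂ} {D : Matrix d d ℂ} (h : HasMatDeriv Θ M D θ)
    (hM : ∀ t, (M t).IsHermitian) : D.IsHermitian := by
  ext i j
  have h1 : HasDerivWithinAt (fun t => M t i j) (star (D j i)) Θ θ := by
    have := (h j i).star
    simpa only [(hM _).apply] using this
  exact (uniqueDiffWithinAt_iff_accPt.mpr hacc).eq_deriv _ h1 (h i j)

/-- Trace preservation: `Tr_B Γ = 1` for every Choi operator `Γ` of the family. -/
theorem HasMatDeriv.partialTraceRight_eq_zero {Θ : Set ℝ} {θ : ℝ} (hacc : AccPt θ (𝓟 Θ))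
    {N : ℝ → Channel A B} {D : Matrix (A × B) (A × B) ℂ}
    (h : HasMatDeriv Θ (fun t => (N t).choi) D θ) : partialTraceRight D = 0 := by
  ext a a'
  have h1 : HasDerivWithinAt (fun t => partialTraceRight (N t).choi a a')
      (partialTraceRight D a a') Θ θ := by
    simp only [partialTraceRight, of_apply]
    exact HasDerivWithinAt.fun_sum fun b _ => h _ _
  simp only [Channel.partialTraceRight_choi] at h1
  exact (uniqueDiffWithinAt_iff_accPt.mpr hacc).eq_deriv _ h1 (hasDerivWithinAt_const _ _ _)

/-- One use of the channel family adds at most the RLD Fisher information of the family. -/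
theorem RLDBound.applyRight {Θ : Set ℝ} {N : ℝ → Channel A B} {θ : ℝ} (hacc : AccPt θ (𝓟 Θ))
    (hN : DifferentiableFamilyAt Θ N θ)
    (hs : supp (matDeriv Θ (fun t => (N t).choi) θ) ≤ supp (N θ).choi) {k : ℕ}
    {ρ : ℝ → State (Fin k × A)} {D : Matrix (Fin k × A) (Fin k × A) ℂ} {c : ℝ}
    (hD : HasMatDeriv Θ (fun t => (ρ t).mat) D θ) (hc : RLDBound (ρ θ).mat D c) :
    ∃ D', HasMatDeriv Θ (fun t => ((N t).applyRight (ρ t)).mat) D' θ ∧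
      RLDBound ((N θ).applyRight (ρ θ)).mat D'
        (c + opNorm (partialTraceRight (matDeriv Θ (fun t => (N t).choi) θ *
          suppInv (N θ).choi * matDeriv Θ (fun t => (N t).choi) θ))) := by
  have hdΓ := hasMatDeriv_choi hN
  set dΓ := matDeriv Θ (fun t => (N t).choi) θ
  have hdΓH : dΓ.IsHermitian := hdΓ.isHermitian hacc fun t => (N t).choi_posSemidef.1
  obtain ⟨Q, hQ, h01, h10, h11, h00⟩ :=
    exists_posSemidef_block (N θ).choi_posSemidef hdΓH hs
  have hZ : (block Q 0 0).IsHermitian := (block_posSemidef hQ 0).1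
  have hstep := hc.choiAct hQ (h10.trans h01.symm) (h11 ▸ (N θ).partialTraceRight_choi)
    (h01 ▸ hdΓ.partialTraceRight_eq_zero hacc)
    (fun Y hY => trace_mul_transpose_le_opNorm (isHermitian_partialTraceRight hZ) hY)
    (ρ θ).trace_one
  rw [h11, h01, h00] at hstep
  have happ : ∀ t, ((N t).applyRight (ρ t)).mat = QEst.choiAct (N t).choi (ρ t).mat := fun t =>
    (N t).ampliation_eq_choiAct _
  refine ⟨QEst.choiAct (N θ).choi D + QEst.choiAct dΓ (ρ θ).mat, ?_, ?_⟩
  · simp only [happ]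
    exact hdΓ.choiAct hD
  · rw [happ]
    exact hstep

/-- Just before use number `i + 1`, the RLD Fisher information is at most `i` times that of the
channel family: the interleaving channels do not increase it. -/
theorem SequentialProtocol.rldBound_stateBefore {Θ : Set ℝ} {N : ℝ → Channel A B} {θ : ℝ}
    (hacc : AccPt θ (𝓟 Θ)) (hN : DifferentiableFamilyAt Θ N θ)
    (hs : supp (matDeriv Θ (fun t => (N t).choi) θ) ≤ supp (N θ).choi) {n : ℕ}
    (P : SequentialProtocol A B n) (i : ℕ) (hi : i < n) :
    ∃ D, HasMatDeriv Θ (fun t => (P.stateBefore (N t) i hi).mat) D θ ∧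
      RLDBound (P.stateBefore (N θ) i hi).mat D
        (i * opNorm (partialTraceRight (matDeriv Θ (fun t => (N t).choi) θ *
          suppInv (N θ).choi * matDeriv Θ (fun t => (N t).choi) θ))) := by
  induction i with
  | zero =>
    refine ⟨0, fun i j => hasDerivWithinAt_const θ Θ (P.init.mat i j), ?_⟩
    rw [Nat.cast_zero, zero_mul]
    exact rldBound_zero P.init.psd
  | succ i ih =>
    obtain ⟨D, hD, hc⟩ := ih (Nat.lt_of_succ_lt hi)
    obtain ⟨D', hD', hc'⟩ := hc.applyRight hacc hN hs hD
    refine ⟨(P.inter i hi).toFun D', hD'.toFun _, ?_⟩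
    have := hc'.map (P.inter i hi)
    rw [Nat.cast_succ, add_one_mul]
    exact this

theorem SequentialProtocol.rldBound_finalState {Θ : Set ℝ} {N : ℝ → Channel A B} {θ : ℝ}
    (hacc : AccPt θ (𝓟 Θ)) (hN : DifferentiableFamilyAt Θ N θ)
    (hs : supp (matDeriv Θ (fun t => (N t).choi) θ) ≤ supp (N θ).choi) {n : ℕ}
    (P : SequentialProtocol A B n) :
    ∃ D, HasMatDeriv Θ (fun t => (P.finalState (N t)).mat) D θ ∧
      RLDBound (P.finalState (N θ)).mat D
        (n * opNorm (partialTraceRight (matDeriv Θ (fun t => (N t).choi) θ *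
          suppInv (N θ).choi * matDeriv Θ (fun t => (N t).choi) θ))) := by
  obtain ⟨D, hD, hc⟩ := P.rldBound_stateBefore hacc hN hs (n - 1) (Nat.sub_lt P.pos Nat.one_pos)
  obtain ⟨D', hD', hc'⟩ := hc.applyRight hacc hN hs hD
  refine ⟨D', hD', ?_⟩
  rw [← add_one_mul, ← Nat.cast_succ, Nat.succ_eq_add_one, Nat.sub_add_cancel P.pos] at hc'
  exact hc'

/-- The Cramér–Rao bound for sequential protocols. With vanishing Fisher information and finite
variance `one_le_mul_variance` would read `1 ≤ 0`, so the convention `1 / 0 = ⊤` is covered. -/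
theorem SequentialProtocol.one_div_le_variance {Θ : Set ℝ} {N : ℝ → Channel A B} {θ : ℝ}
    (hθ : θ ∈ Θ) (hacc : AccPt θ (𝓟 Θ)) (hN : DifferentiableFamilyAt Θ N θ) {n : ℕ}
    (P : SequentialProtocol A B n) (hP : P.IsUnbiased Θ N) :
    1 / ((n : ℝ≥0∞) * rldFisherChannel Θ N θ) ≤ P.variance (N θ) := by
  rw [rldFisherChannel]
  split_ifs with hs
  · set I := opNorm (partialTraceRight (matDeriv Θ (fun t => (N t).choi) θ *
      suppInv (N θ).choi * matDeriv Θ (fun t => (N t).choi) θ))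
    by_cases hv : P.variance (N θ) = ⊤
    · rw [hv]
      exact le_top
    obtain ⟨D, hD, hc⟩ := P.rldBound_finalState hacc hN hs
    have hL2 : MemLp (fun x : ℝ => x) 2 (P.meas.law (P.finalState (N θ))) := by
      refine (evariance_lt_top_iff_memLp ?_).mp (lt_top_iff_ne_top.mpr hv)
      exact measurable_id.aestronglyMeasurable
    have h1 := one_le_mul_variance P.meas (ω := fun t => P.finalState (N t)) hθ hacc hD hP hc hL2
    have hI : 0 ≤ I := norm_nonneg _
    have h2 : P.variance (N θ) =
        ENNReal.ofReal (Var[fun x : ℝ => x; P.meas.law (P.finalState (N θ))]) :=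
      hL2.ofReal_variance_eq.symm
    refine ENNReal.div_le_of_le_mul ?_
    rw [h2, ← ENNReal.ofReal_natCast, ← ENNReal.ofReal_mul (Nat.cast_nonneg n),
      ← ENNReal.ofReal_mul (variance_nonneg _ _), ← ENNReal.ofReal_one]
    exact ENNReal.ofReal_le_ofReal (by rw [mul_comm]; exact h1)
  · rw [ENNReal.mul_top (by exact_mod_cast P.pos.ne')]
    simp

end Sequential

end QEst

theorem mainTheorem2 {A B : Type*} [Fintype A] [DecidableEq A] [Fintype B] [DecidableEq B]
    (Θ : Set ℝ) (N : ℝ → QEst.Channel A B) (θ : ℝ) (hθ : θ ∈ Θ) (hacc : AccPt θ (𝓟 Θ))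
    (hN : QEst.DifferentiableFamilyAt Θ N θ) :
    (∀ (n : ℕ) (P : QEst.SequentialProtocol A B n), P.IsUnbiased Θ N →
      1 / ((n : ℝ≥0∞) * QEst.rldFisherChannel Θ N θ) ≤ P.variance (N θ)) ∧
    (QEst.rldFisherChannel Θ N θ < ⊤ →
      ∀ C : ℝ≥0, ∀ᶠ n : ℕ in atTop, ∀ P : QEst.SequentialProtocol A B n, P.IsUnbiased Θ N →
        (C : ℝ≥0∞) / (n : ℝ≥0∞) ^ 2 < P.variance (N θ)) := by
  have h1 : ∀ (n : ℕ) (P : QEst.SequentialProtocol A B n), P.IsUnbiased Θ N →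
      1 / ((n : ℝ≥0∞) * QEst.rldFisherChannel Θ N θ) ≤ P.variance (N θ) :=
    fun n P hP => P.one_div_le_variance hθ hacc hN hP
  refine ⟨h1, fun hI C => ?_⟩
  -- `C / n² < 1 / (n I)` holds as soon as `C I < n`.
  have hCI : (C : ℝ≥0∞) * QEst.rldFisherChannel Θ N θ ≠ ⊤ :=
    ENNReal.mul_ne_top ENNReal.coe_ne_top hI.ne
  obtain ⟨m, hm⟩ := ENNReal.exists_nat_gt hCI
  filter_upwards [eventually_ge_atTop m] with n hn P hP
  refine lt_of_lt_of_le ?_ (h1 n P hP)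
  have hn0 : (n : ℝ≥0∞) ≠ 0 := by exact_mod_cast P.pos.ne'
  have hnt : (n : ℝ≥0∞) ≠ ⊤ := ENNReal.natCast_ne_top n
  have hlt : (C : ℝ≥0∞) * QEst.rldFisherChannel Θ N θ < n :=
    hm.trans_le (by exact_mod_cast hn)
  generalize QEst.rldFisherChannel Θ N θ = I at *
  rw [ENNReal.div_lt_iff (Or.inl (pow_ne_zero 2 hn0)) (Or.inl (ENNReal.pow_ne_top hnt))]
  by_cases hI0 : I = 0
  · subst hI0
    rw [mul_zero, ENNReal.div_zero one_ne_zero, ENNReal.top_mul (pow_ne_zero 2 hn0)]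
    exact ENNReal.coe_lt_top
  · have he : 1 / ((n : ℝ≥0∞) * I) * (n : ℝ≥0∞) ^ 2 = n / I := by
      rw [one_div, ENNReal.mul_inv (Or.inl hn0) (Or.inl hnt), sq, ENNReal.div_eq_inv_mul]
      calc _ = ((n : ℝ≥0∞)⁻¹ * n) * (I⁻¹ * n) := by ring
        _ = _ := by rw [ENNReal.inv_mul_cancel hn0 hnt, one_mul]
    rw [he, ENNReal.lt_div_iff_mul_lt (Or.inl hI0) (Or.inl hI.ne)]
    exact hlt
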